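/- **Theorem.** Let $\mathcal C$ be a category, $(T,\mu,\eta)$ a monad on $\mathcal C$ and $F$ an endofunctor of $\mathcal C$. Let $\alpha$ be an ordinal with its Alexandrov topology: the opens are the ordinals $\beta\le\alpha$, and a family of $\beta_i\le\beta$ covers $\beta$ iff $\beta=\bigcup_i\beta_i$. Let $\mathrm{Sh}_\alpha(\mathcal C)$ be the category of $\mathcal C$-valued sheaves for this topology, and assume that the inclusion $\mathbf i$ of sheaves into $\mathcal C$-valued presheaves has a left adjoint $\mathbf a$ with unit $u$; thus the constant sheaf adjunction $\Delta\dashv\Gamma$ is defined, where $\Delta$ sheafifies constant presheaves and $\Gamma(X)=X_\alpha$. Notation. * The pointwise extension of an endofunctor $G$ of $\mathcal C$ is $\overline G=\mathbf a\circ(G\circ-)\circ\mathbf i$, an endofunctor of $\mathrm{Sh}_\alpha(\mathcal C)$. The functor $\overline T$ carries the monad structure with unit $X\cong\mathbf a\mathbf i X\xrightarrow{\mathbf a\eta}\overline TX$ and multiplication $\overline T\,\overline TX\cong\overline{TT}X\xrightarrow{\mathbf a\mu}\overline TX$, where the isomorphisms are induced by $\mathbf a\dashv\mathbf i$. * The later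 functor is $\blacktriangleright=\mathbf a\circ p^*\circ\mathbf i$, where $p(\beta)=\sup\{\gamma\mid\gamma<\beta\}$ and $p^*X=X\circ p$. * A final sequence of $F$ is a functor $\Phi\colon\mathrm{Ord}^{op}\to\mathcal C$ with $\Phi_{\beta+1}=F\Phi_\beta$ and $(\Phi_{\beta'+1}\to\Phi_{\beta+1})=F(\Phi_{\beta'}\to\Phi_\beta)$ for all $\beta\le\beta'$, and with $\Phi_\gamma=\lim_{\beta<\gamma}\Phi_\beta$ (via the maps $\Phi_\gamma\to\Phi_\beta$) whenever $\gamma$ is $0$ or a limit ordinal. It is stable at $\alpha$ if $\Phi_{\alpha+1}\to\Phi_\alpha$ is an isomorphism. Its restriction to the ordinals $\beta\le\alpha$ is a sheaf, denoted $\Phi(F)$. * $K\colon\mathrm{Sh}_\alpha(\mathcal C)\to\mathrm{Kl}(\overline T)$ is the canonical functor to the Kleisli category. A Kleisli lifting of an endofunctor $G$ of $\mathrm{Sh}_\alpha(\mathcal C)$ is an endofunctor $H$ of $\mathrm{Kl}(\overline T)$ with $H\circ K=K\circ G$. * An invariant of an endofunctor $H$ is an object $X$ with an isomorphism $X\cong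 HX$. Assume that a final sequence of $F$ exists and is stable at $\alpha$, and let $H$ be any Kleisli lifting of $\overline F\blacktriangleright$ to $\mathrm{Kl}(\overline T)$. Then: 1. There is exactly one isomorphism $c\colon\Phi(F)\to\overline F\blacktriangleright\Phi(F)$ in $\mathrm{Sh}_\alpha(\mathcal C)$ that is the identity of $\Phi(F)$, in the sense that at every stage $\beta+1\le\alpha$ its component is the canonical identification $\Phi_{\beta+1}=F\Phi_\beta=F\Phi_{p(\beta+1)}\cong F\big((\blacktriangleright\Phi(F))_{\beta+1}\big)\cong\big(\overline F\blacktriangleright\Phi(F)\big)_{\beta+1}$ given by components of $u$. 2. Up to unique isomorphism, the only invariant of $H$ is $K(c)\colon K\Phi(F)\to K\overline F\blacktriangleright\Phi(F)=HK\Phi(F)$, the image of the identity on $\Phi(F)$: for every invariant $k\colon Y\cong HY$ there is exactly one isomorphism $i\colon Y\to K\Phi(F)$ with $H(i)\circ k=K(c)\circ i$. Moreover $K(c)$ is a final $H$-coalgebra and $K(c)^{-1}$ is an initial $H$-algebra. -/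

import Mathlib

open CategoryTheory CategoryTheory.Limits Opposite

universe w v u

noncomputable section

namespace KleisliTrace

/-! ### Sheaves on the Alexandrov topology of an ordinal -/

/-- The open sets of an ordinal `α = {γ | γ < α}` for the Alexandrov topology are its downward
closed subsets, that is, the ordinals `β = {γ | γ < β}` with `β ≤ α`. They form a poset. -/
abbrev Stage (α : Ordinal.{w}) : Type (w + 1) := Set.Iic α

/-- The coverage by open covers: a sieve on the open `β = {γ | γ < β}` is covering iff
every point `γ < β` lies in some member `δ = {γ | γ < δ}` of the sieve. -/
def alexandrov (α : Ordinal.{w}) : GrothendieckTopology (Stage α) where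
  sieves β := {S | ∀ γ : Ordinal.{w}, γ < β.1 → ∃ (δ : Stage α) (f : δ ⟶ β), S f ∧ γ < δ.1}
  top_mem' β γ hγ := ⟨β, 𝟙 β, trivial, hγ⟩
  pullback_stable' {β β'} S f hS γ hγ := by
    obtain ⟨δ, g, hg, hδ⟩ := hS γ (lt_of_lt_of_le hγ (leOfHom f))
    refine ⟨δ ⊓ β', homOfLE inf_le_right, ?_, ?_⟩
    · change S _
      have := S.downward_closed hg (homOfLE (inf_le_left : δ ⊓ β' ≤ δ))
      exact this
    · rcases le_total δ β' with h | h
      · rwa [inf_eq_left.2 h]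
      · rwa [inf_eq_right.2 h]
  transitive' {β} S hS R hR γ hγ := by
    obtain ⟨δ, g, hg, hδ⟩ := hS γ hγ
    obtain ⟨ε, k, hk, hε⟩ := hR hg γ hδ
    exact ⟨ε, k ≫ g, hk, hε⟩

/-- The category of `C`-valued sheaves on `α`. -/
abbrev Sh (α : Ordinal.{w}) (C : Type u) [Category.{v} C] := Sheaf (alexandrov α) C

/-- The constant sheaf functor `Δ`: the sheafification of the constant presheaf. -/
abbrev Delta (α : Ordinal.{w}) (C : Type u) [Category.{v} C] [HasWeakSheafify (alexandrov α) C] :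
    C ⥤ Sh α C :=
  constantSheaf (alexandrov α) C

/-- The global sections functor `Γ`: the value of a sheaf at the whole space `α`, which is the
limit of the sheaf because `α` is the largest stage. -/
abbrev Gamma (α : Ordinal.{w}) (C : Type u) [Category.{v} C] : Sh α C ⥤ C :=
  (sheafSections (alexandrov α) C).obj (op ⊤)

/-- The constant sheaf adjunction `Δ ⊣ Γ`, defined when the inclusion of sheaves into presheaves
has a left adjoint, the sheafification functor. -/
def deltaGammaAdj (α : Ordinal.{w}) (C : Type u) [Category.{v} C]
    [HasWeakSheafify (alexandrov α) C] : Delta α C ⊣ Gamma α C :=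
  constantSheafAdj (alexandrov α) C (IsTerminal.ofUniqueHom (fun β => homOfLE β.2)
    (fun _ _ => Subsingleton.elim _ _))

/-! ### Pointwise extensions of endofunctors, and the later functor -/

section Functors

variable (α : Ordinal.{w}) {C : Type u} [Category.{v} C] [HasWeakSheafify (alexandrov α) C]

/-- The pointwise extension of an endofunctor `F` to sheaves: include sheaves into presheaves,
apply `F` at each stage, sheafify. -/
def extP (F : C ⥤ C) : Sh α C ⥤ Sh α C :=
  sheafToPresheaf (alexandrov α) C ⋙ (Functor.whiskeringRight (Stage α)ᵒᵖ C C).obj F ⋙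
    presheafToSheaf (alexandrov α) C

variable {α} in
/-- The predecessor map `p β = sup {γ | γ < β}`: so `p (β + 1) = β`, and `p β = β` if `β` is zero
or a limit ordinal. -/
def pred (β : Stage α) : Stage α :=
  ⟨sSup (Set.Iio β.1), Set.mem_Iic.2 (csSup_le' fun _ hγ => (le_of_lt hγ).trans β.2)⟩

lemma pred_mono : Monotone (pred : Stage α → Stage α) := by
  intro β β' h
  have h' : β.1 ≤ β'.1 := h
  refine Subtype.mk_le_mk.2 (csSup_le' fun γ hγ => le_csSup ⟨β'.1, fun x hx => le_of_lt hx⟩ ?_)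
  exact lt_of_lt_of_le (Set.mem_Iio.1 hγ) h'

/-- The later endofunctor: precompose with the predecessor map, then sheafify. -/
def later : Sh α C ⥤ Sh α C :=
  sheafToPresheaf (alexandrov α) C ⋙
    (Functor.whiskeringLeft (Stage α)ᵒᵖ (Stage α)ᵒᵖ C).obj (pred_mono α).functor.op ⋙
    presheafToSheaf (alexandrov α) C

end Functors

/-! ### Sheafification only depends on the successor stages -/

section Successors

variable {α : Ordinal.{w}} {C : Type u} [Category.{v} C]

/-- The successor stages. -/
def isSuccStage (α : Ordinal.{w}) : ObjectProperty (Stage α) :=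
  fun β => ∃ γ : Ordinal.{w}, β.1 = Order.succ γ

instance : (isSuccStage α).ι.IsCoverDense (alexandrov α) where
  is_cover β γ hγ := by
    let δ : Stage α := ⟨Order.succ γ, (Order.succ_le_of_lt hγ).trans β.2⟩
    exact ⟨δ, homOfLE (Order.succ_le_of_lt hγ : δ.1 ≤ β.1),
      Presieve.in_coverByImage (isSuccStage α).ι (Y := ⟨δ, γ, rfl⟩) _, Order.lt_succ γ⟩

/-- A morphism of presheaves that is invertible at all successor stages is inverted by
sheafification. -/
lemma W_of_isIso_succ {P Q : (Stage α)ᵒᵖ ⥤ C} (f : P ⟶ Q)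
    (hf : ∀ β : Stage α, isSuccStage α β → IsIso (f.app (op β))) : (alexandrov α).W f := by
  intro G hG
  let ι := (isSuccStage α).ι
  have hP := Functor.whiskerLeft_obj_map_bijective_of_isCoverDense (K := alexandrov α) ι P G hG
  have hQ := Functor.whiskerLeft_obj_map_bijective_of_isCoverDense (K := alexandrov α) ι Q G hG
  have : IsIso (Functor.whiskerLeft ι.op f) := by
    have : ∀ X, IsIso ((Functor.whiskerLeft ι.op f).app X) := fun X => hf _ X.unop.2
    exact NatIso.isIso_of_isIso_app _
  constructor
  · intro a b hab
    apply hQ.1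
    have h := congrArg (Functor.whiskerLeft ι.op) hab
    simp only [Functor.whiskerLeft_comp] at h
    exact (cancel_epi (Functor.whiskerLeft ι.op f)).1 h
  · intro g
    obtain ⟨g', hg'⟩ := hQ.2 (inv (Functor.whiskerLeft ι.op f) ≫ Functor.whiskerLeft ι.op g)
    refine ⟨g', hP.1 ?_⟩
    change Functor.whiskerLeft ι.op (f ≫ g') = Functor.whiskerLeft ι.op g
    change Functor.whiskerLeft ι.op g' = _ at hg'
    rw [Functor.whiskerLeft_comp, hg', IsIso.hom_inv_id_assoc]

/-- The presheaf with value `Z` at the stages above `β` and a terminal object `t` elsewhere. -/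
def sky (β : Ordinal.{w}) {t : C} (ht : IsTerminal t) (Z : C) : (Stage α)ᵒᵖ ⥤ C where
  obj δ := open Classical in if β < δ.unop.1 then Z else t
  map {δ δ'} f := open Classical in
    if h : β < δ'.unop.1 then
      eqToHom ((if_pos (h.trans_le (leOfHom f.unop))).trans (if_pos h).symm)
    else ht.from _ ≫ eqToHom (if_neg h).symm
  map_id δ := by
    split_ifs with h
    · rfl
    · rw [← cancel_mono (eqToHom (if_neg h))]
      exact ht.hom_ext _ _
  map_comp {δ δ' δ''} f g := by
    by_cases h : β < δ''.unop.1
    · have h' := h.trans_le (leOfHom g.unop)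
      simp [h, h']
    · rw [dif_neg h, dif_neg h, ← Category.assoc]
      congr 1
      exact ht.hom_ext _ _

variable (β : Ordinal.{w}) {t : C} (ht : IsTerminal t)

lemma sky_obj (Z : C) {δ : (Stage α)ᵒᵖ} (h : β < δ.unop.1) : (sky β ht Z).obj δ = Z := if_pos h

lemma sky_map (Z : C) {δ δ' : (Stage α)ᵒᵖ} (f : δ ⟶ δ') (h : β < δ'.unop.1) :
    (sky β ht Z).map f =
      eqToHom ((sky_obj β ht Z (h.trans_le (leOfHom f.unop))).trans (sky_obj β ht Z h).symm) :=
  dif_pos h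

lemma sky_hom_ext (Z : C) {E : C} {δ : (Stage α)ᵒᵖ} (h : ¬ β < δ.unop.1)
    (a b : E ⟶ (sky β ht Z).obj δ) : a = b := by
  have e : (sky β ht Z).obj δ = t := if_neg h
  rw [← cancel_mono (eqToHom e)]
  exact ht.hom_ext _ _

lemma sky_isIso_map (Z : C) {δ δ' : (Stage α)ᵒᵖ} (f : δ ⟶ δ') (h : β < δ'.unop.1) :
    IsIso ((sky β ht Z).map f) := by
  rw [sky_map β ht Z f h]
  infer_instance

lemma sky_isSheaf (Z : C) : Presheaf.IsSheaf (alexandrov α) (sky β ht Z) := by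
  intro E δ S hS x hx
  by_cases h : β < δ.1
  · obtain ⟨ε, f, hf, hε⟩ := hS β h
    have := sky_isIso_map (α := α) β ht Z f.op hε
    refine ⟨x f hf ≫ inv ((sky β ht Z).map f.op), ?_, ?_⟩
    · intro ε' f' hf'
      by_cases h' : β < ε'.1
      · change (x f hf ≫ inv ((sky β ht Z).map f.op)) ≫ (sky β ht Z).map f'.op = x f' hf'
        let m : Stage α := ε ⊓ ε'
        have hm : β < m.1 := lt_inf_iff.2 ⟨hε, h'⟩
        let g : m ⟶ ε := homOfLE inf_le_left
        let g' : m ⟶ ε' := homOfLE inf_le_right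
        have key := hx g g' hf hf' (Subsingleton.elim _ _)
        change x f hf ≫ (sky β ht Z).map g.op = x f' hf' ≫ (sky β ht Z).map g'.op at key
        have := sky_isIso_map (α := α) β ht Z g'.op hm
        have e : (sky β ht Z).map f'.op ≫ (sky β ht Z).map g'.op =
            (sky β ht Z).map f.op ≫ (sky β ht Z).map g.op := by
          rw [← Functor.map_comp, ← Functor.map_comp]
          exact congrArg _ (Subsingleton.elim _ _)
        rw [← cancel_mono ((sky β ht Z).map g'.op), ← key, Category.assoc, Category.assoc, e,
          IsIso.inv_hom_id_assoc]
      · exact sky_hom_ext β ht Z h' _ _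
    · intro y hy
      have := hy f hf
      change y ≫ (sky β ht Z).map f.op = _ at this
      rw [← this, Category.assoc, IsIso.hom_inv_id, Category.comp_id]
  · refine ⟨ht.from _ ≫ eqToHom (if_neg h).symm, ?_, ?_⟩
    · intro ε f hf
      exact sky_hom_ext β ht Z (fun h' => h (h'.trans_le (leOfHom f))) _ _
    · intro y _
      exact sky_hom_ext β ht Z h _ _

/-- Morphisms into `sky` from values at the successor stage of `β`. -/
def toSky {P : (Stage α)ᵒᵖ ⥤ C} (hβ : Order.succ β ∈ Set.Iic α) {Z : C}
    (z : P.obj (op ⟨Order.succ β, hβ⟩) ⟶ Z) : P ⟶ sky β ht Z where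
  app δ := open Classical in
    if h : β < δ.unop.1 then
      P.map (homOfLE (Order.succ_le_of_lt h : (⟨Order.succ β, hβ⟩ : Stage α) ≤ δ.unop)).op ≫ z ≫
        eqToHom (sky_obj β ht Z h).symm
    else ht.from _ ≫ eqToHom (if_neg h).symm
  naturality δ δ' f := by
    by_cases h : β < δ'.unop.1
    · have h' := h.trans_le (leOfHom f.unop)
      rw [dif_pos h, dif_pos h', sky_map β ht Z f h, ← Category.assoc, ← Functor.map_comp]
      simp only [Category.assoc, eqToHom_trans]
      rfl
    · exact sky_hom_ext β ht Z h _ _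

lemma toSky_app {P : (Stage α)ᵒᵖ ⥤ C} (hβ : Order.succ β ∈ Set.Iic α) {Z : C}
    (z : P.obj (op ⟨Order.succ β, hβ⟩) ⟶ Z) :
    (toSky β ht hβ z).app (op ⟨Order.succ β, hβ⟩) = 
      z ≫ eqToHom (sky_obj β ht Z (Order.lt_succ β)).symm := by
  have : (toSky β ht hβ z).app (op ⟨Order.succ β, hβ⟩) = P.map (𝟙 _) ≫ z ≫ _ :=
    dif_pos (Order.lt_succ β)
  rw [this, P.map_id, Category.id_comp]

lemma comp_toSky {P Q : (Stage α)ᵒᵖ ⥤ C} (f : P ⟶ Q) (hβ : Order.succ β ∈ Set.Iic α) {Z : C}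
    (z : Q.obj (op ⟨Order.succ β, hβ⟩) ⟶ Z) :
    f ≫ toSky β ht hβ z = toSky β ht hβ (f.app _ ≫ z) := by
  ext δ
  by_cases h : β < δ.unop.1
  · have e₁ : (toSky β ht hβ z).app δ = Q.map _ ≫ z ≫ _ := dif_pos h
    have e₂ : (toSky β ht hβ (f.app _ ≫ z)).app δ = P.map _ ≫ (f.app _ ≫ z) ≫ _ := dif_pos h
    rw [NatTrans.comp_app, e₁, e₂]
    simp
  · exact sky_hom_ext β ht Z h _ _

/-- Conversely, a morphism of presheaves inverted by sheafification is invertible at all successor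
stages. -/
lemma isIso_succ_of_W [HasWeakSheafify (alexandrov α) C] {P Q : (Stage α)ᵒᵖ ⥤ C} (f : P ⟶ Q)
    (hf : (alexandrov α).W f) (β : Stage α) (hβ : isSuccStage α β) : IsIso (f.app (op β)) := by
  obtain ⟨β, hβα⟩ := β
  obtain ⟨γ, rfl⟩ : ∃ γ, β = Order.succ γ := hβ
  let bot : Stage α := ⟨0, Set.mem_Iic.2 (zero_le (a := α))⟩
  have ht : IsTerminal (((presheafToSheaf (alexandrov α) C).obj P).obj.obj (op bot)) :=
    Sheaf.isTerminalOfBotCover _ _ (fun δ hδ => absurd hδ (not_lt_bot))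
  obtain ⟨ψ, hψ⟩ := (hf _ (sky_isSheaf γ ht (P.obj (op ⟨Order.succ γ, hβα⟩)))).2
    (toSky γ ht hβα (𝟙 _))
  have e : (sky γ ht (P.obj (op ⟨Order.succ γ, hβα⟩))).obj (op ⟨Order.succ γ, hβα⟩) =
    P.obj (op ⟨Order.succ γ, hβα⟩) := sky_obj γ ht _ (Order.lt_succ γ)
  let s := ψ.app (op ⟨Order.succ γ, hβα⟩) ≫ eqToHom e
  have hs : f.app _ ≫ s = 𝟙 _ := by
    have := congrArg (fun k => NatTrans.app k (op ⟨Order.succ γ, hβα⟩) ≫ eqToHom e) hψ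
    dsimp only at this
    rw [NatTrans.comp_app, toSky_app, Category.assoc, Category.id_comp, eqToHom_trans,
      eqToHom_refl] at this
    exact this
  refine ⟨s, hs, ?_⟩
  have h := (hf _ (sky_isSheaf γ ht (Q.obj (op ⟨Order.succ γ, hβα⟩)))).1
    (a₁ := toSky γ ht hβα (s ≫ f.app _)) (a₂ := toSky γ ht hβα (𝟙 _)) (by
      change f ≫ _ = f ≫ _
      rw [comp_toSky, comp_toSky, reassoc_of% hs, Category.comp_id])
  have := congrArg (fun k => NatTrans.app k (op ⟨Order.succ γ, hβα⟩)) h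
  rw [toSky_app, toSky_app] at this
  exact (cancel_mono _).1 this

lemma W_iff_isIso_succ [HasWeakSheafify (alexandrov α) C] {P Q : (Stage α)ᵒᵖ ⥤ C} (f : P ⟶ Q) :
    (alexandrov α).W f ↔ ∀ β : Stage α, isSuccStage α β → IsIso (f.app (op β)) :=
  ⟨isIso_succ_of_W f, W_of_isIso_succ f⟩

/-- Applying an endofunctor at each stage preserves the morphisms inverted by sheafification. -/
lemma W_whiskerRight [HasWeakSheafify (alexandrov α) C] {P Q : (Stage α)ᵒᵖ ⥤ C} (f : P ⟶ Q)
    (hf : (alexandrov α).W f) (F : C ⥤ C) : (alexandrov α).W (Functor.whiskerRight f F) := by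
  rw [W_iff_isIso_succ] at hf ⊢
  intro β hβ
  have := hf β hβ
  exact inferInstanceAs (IsIso (F.map (f.app (op β))))

end Successors

/-! ### The pointwise extension of a monad -/

section Monads

/-- A monad on `C` acts on presheaves, stage by stage. -/
def presheafMonad (I : Type*) [Category* I] {C : Type u} [Category.{v} C] (T : Monad C) :
    Monad (I ⥤ C) where
  toFunctor := (Functor.whiskeringRight I C C).obj T.toFunctor
  η := { app := fun P => { app := fun i => T.η.app (P.obj i)
                           naturality := fun _ _ f => T.η.naturality (P.map f) }
         naturality := fun _ _ f => by ext i; exact T.η.naturality (f.app i) }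
  μ := { app := fun P => { app := fun i => T.μ.app (P.obj i)
                           naturality := fun _ _ f => T.μ.naturality (P.map f) }
         naturality := fun _ _ f => by ext i; exact T.μ.naturality (f.app i) }
  assoc P := by ext i; exact T.assoc (P.obj i)
  left_unit P := by ext i; exact T.left_unit (P.obj i)
  right_unit P := by ext i; exact T.right_unit (P.obj i)

lemma isIso_map_map {D S : Type*} [Category* D] [Category* S] {L : D ⥤ S} {R : S ⥤ D}
    (adj : L ⊣ R) (M : Monad D) (hM : ∀ P, IsIso (L.map (M.map (adj.unit.app P))))
    {P Q : D} (f : P ⟶ Q) (hf : IsIso (L.map f)) : IsIso (L.map (M.map f)) := by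
  have h : L.map (M.map f) ≫ L.map (M.map (adj.unit.app Q)) =
      L.map (M.map (adj.unit.app P)) ≫ L.map (M.map (R.map (L.map f))) := by
    rw [← L.map_comp, ← L.map_comp, ← M.map_comp, ← M.map_comp]
    exact congrArg _ (congrArg _ (adj.unit.naturality f))
  have := hM P
  have := hM Q
  exact IsIso.of_isIso_fac_right h

variable {D S : Type*} [Category* D] [Category* S] {L : D ⥤ S} {R : S ⥤ D} (adj : L ⊣ R)
  [R.Full] [R.Faithful] (M : Monad D)

lemma inv_counit_app_obj (Z : D) : inv (adj.counit.app (L.obj Z)) = L.map (adj.unit.app Z) := by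
  rw [IsIso.inv_eq_of_inv_hom_id]
  exact adj.left_triangle_components Z

lemma map_inv_counit_app (X : S) : R.map (inv (adj.counit.app X)) = adj.unit.app (R.obj X) := by
  rw [Functor.map_inv]
  rw [IsIso.inv_eq_of_inv_hom_id]
  exact adj.right_triangle_components X

/-- The monad `X ↦ L (M (R X))` on a reflective subcategory. Its unit is `X ≅ L R X ⟶ L M R X` and
its multiplication is `L M R L M R X ≅ L M M R X ⟶ L M R X`, where the isomorphisms are induced by
the counit and the unit of the reflection. -/
def reflectMonad (hM : ∀ P, IsIso (L.map (M.map (adj.unit.app P)))) : Monad S where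
  toFunctor := R ⋙ M.toFunctor ⋙ L
  η :=
    { app := fun X => inv (adj.counit.app X) ≫ L.map (M.η.app (R.obj X))
      naturality := fun X Y f => by
        have h₁ := adj.counit.naturality f
        have h₂ := M.η.naturality (R.map f)
        dsimp at h₁ h₂ ⊢
        rw [Category.assoc, ← L.map_comp, ← h₂, L.map_comp, ← Category.assoc, ← Category.assoc]
        congr 1
        rw [IsIso.eq_inv_comp, ← Category.assoc, IsIso.comp_inv_eq, h₁] }
  μ :=
    { app := fun X =>
        inv (L.map (M.map (adj.unit.app (M.obj (R.obj X))))) ≫ L.map (M.μ.app (R.obj X))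
      naturality := fun X Y f => by
        have h₁ := adj.unit.naturality (M.map (R.map f))
        have h₂ := M.μ.naturality (R.map f)
        dsimp at h₁ h₂ ⊢
        rw [← cancel_epi (L.map (M.map (adj.unit.app (M.obj (R.obj X)))))]
        simp only [Category.assoc, IsIso.hom_inv_id_assoc]
        rw [← L.map_comp, ← h₂, ← L.map_comp_assoc, ← M.map_comp, ← h₁, M.map_comp,
          L.map_comp_assoc, IsIso.hom_inv_id_assoc, L.map_comp] }
  assoc X := by
    let Z := M.obj (R.obj X)
    let W := M.obj (R.obj (L.obj Z))
    let A := L.map (M.map (adj.unit.app Z))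
    let B := L.map (M.map (adj.unit.app W))
    -- the unit followed by the multiplication
    have k : M.map (adj.unit.app Z) ≫ adj.unit.app W ≫ R.map (inv A ≫ L.map (M.μ.app (R.obj X))) =
        M.μ.app (R.obj X) ≫ adj.unit.app Z := by
      have h₁ := adj.unit.naturality (M.map (adj.unit.app Z))
      have h₂ := adj.unit.naturality (M.μ.app (R.obj X))
      dsimp at h₁ h₂
      rw [← Category.assoc, h₁, Category.assoc, ← R.map_comp, IsIso.hom_inv_id_assoc, ← h₂]
    have hn := M.μ.naturality (adj.unit.app Z)
    have hA : IsIso (L.map (M.map (M.map (adj.unit.app Z)))) :=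
      isIso_map_map adj M hM _ (hM Z)
    change L.map (M.map (R.map (inv A ≫ L.map (M.μ.app (R.obj X))))) ≫ inv A ≫ L.map _ =
      (inv B ≫ L.map (M.μ.app _)) ≫ inv A ≫ L.map _
    rw [← cancel_epi B, Category.assoc, IsIso.hom_inv_id_assoc,
      ← cancel_epi (L.map (M.map (M.map (adj.unit.app Z))))]
    simp only [B, ← L.map_comp_assoc, ← M.map_comp, k]
    dsimp at hn
    rw [hn, M.map_comp, L.map_comp_assoc, L.map_comp_assoc, IsIso.hom_inv_id_assoc,
      ← L.map_comp, ← L.map_comp, M.assoc]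
  left_unit X := by
    have h := M.η.naturality (adj.unit.app (M.obj (R.obj X)))
    dsimp at h ⊢
    rw [inv_counit_app_obj, Category.assoc, ← L.map_comp_assoc, h, L.map_comp_assoc,
      IsIso.hom_inv_id_assoc, ← L.map_comp, M.left_unit]
    exact L.map_id _
  right_unit X := by
    have h := adj.unit.naturality (M.η.app (R.obj X))
    dsimp at h ⊢
    rw [R.map_comp, map_inv_counit_app, ← h, M.map_comp, L.map_comp_assoc,
      IsIso.hom_inv_id_assoc, ← L.map_comp, M.right_unit]
    exact L.map_id _

/-- The pointwise extension of a monad `T` to sheaves: its underlying functor is `extP α T`, and its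
unit and multiplication are, up to the canonical isomorphisms `X ≅ extP α (𝟭 C) X` and
`extP α T (extP α T X) ≅ extP α (T ⋙ T) X`, the pointwise extensions of those of `T`. -/
def extMonad (α : Ordinal.{w}) {C : Type u} [Category.{v} C] [HasWeakSheafify (alexandrov α) C]
    (T : Monad C) : Monad (Sh α C) :=
  reflectMonad (sheafificationAdjunction (alexandrov α) C) (presheafMonad (Stage α)ᵒᵖ T)
    fun P => ((alexandrov α).W_iff _).1
      (W_whiskerRight _ ((alexandrov α).W_toSheafify P) T.toFunctor)

lemma extMonad_toFunctor (α : Ordinal.{w}) {C : Type u} [Category.{v} C]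
    [HasWeakSheafify (alexandrov α) C] (T : Monad C) :
    (extMonad α T).toFunctor = extP α T.toFunctor := rfl

end Monads

/-! ### Kleisli liftings -/

/-- An endofunctor `H` of the Kleisli category of `T` is a Kleisli lifting of `G` if it agrees with
`G` along the canonical functor `K` into the Kleisli category. -/
def IsKleisliLifting {D : Type*} [Category* D] (T : Monad D) (G : D ⥤ D)
    (H : Kleisli T ⥤ Kleisli T) : Prop :=
  Kleisli.Adjunction.toKleisli T ⋙ H = G ⋙ Kleisli.Adjunction.toKleisli T

/-- The image under `K` of an isomorphism `X ≅ G X`, as an isomorphism `K X ≅ H (K X)` for a Kleisli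
lifting `H` of `G`; note that `H (K X) = K (G X)`. -/
def IsKleisliLifting.mapInvariant {D : Type*} [Category* D] {T : Monad D} {G : D ⥤ D}
    {H : Kleisli T ⥤ Kleisli T} (hH : IsKleisliLifting T G H) {X : D} (c : X ≅ G.obj X) :
    (Kleisli.Adjunction.toKleisli T).obj X ≅ H.obj ((Kleisli.Adjunction.toKleisli T).obj X) :=
  (Kleisli.Adjunction.toKleisli T).mapIso c ≪≫ eqToIso (Functor.congr_obj hH X).symm

/-! ### Invariants -/

/-- An invariant `e : X ≅ H X` of an endofunctor is the unique one if it is a final coalgebra, its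
inverse is an initial algebra, and there is exactly one isomorphism of coalgebras to it from any
other invariant. -/
structure IsUniqueInvariant {D : Type*} [Category* D] (H : D ⥤ D) {X : D} (e : X ≅ H.obj X) :
    Prop where
  unique : ∀ (Y : D) (k : Y ≅ H.obj Y), ∃! i : Y ≅ X, k.hom ≫ H.map i.hom = i.hom ≫ e.hom
  final : Nonempty (IsTerminal (⟨X, e.hom⟩ : Endofunctor.Coalgebra H))
  initial : Nonempty (IsInitial (⟨X, e.inv⟩ : Endofunctor.Algebra H))

/-! ### Final sequences -/

section FinalSequences

variable {C : Type u} [Category.{v} C]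

/-- The cone over `(Φ β)_{β < γ}` given by the restrictions `Φ γ ⟶ Φ β`. -/
def restrictionCone (Φ : Ordinal.{w}ᵒᵖ ⥤ C) (γ : Ordinal.{w}) :
    Cone ((Subtype.mono_coe (· ∈ Set.Iio γ)).functor.op ⋙ Φ) where
  pt := Φ.obj (op γ)
  π :=
    { app := fun β => Φ.map (homOfLE (le_of_lt β.unop.2)).op
      naturality := fun _ _ f => by
        dsimp
        rw [Category.id_comp, ← Φ.map_comp]
        rfl }

/-- A final sequence of an endofunctor `F`: objects `Φ β` for all ordinals `β` and morphisms
`Φ β' ⟶ Φ β` for `β ≤ β'` such that `Φ (β + 1) = F (Φ β)`, the morphism `Φ (β' + 1) ⟶ Φ (β + 1)` is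
`F (Φ β' ⟶ Φ β)`, and `Φ γ` is the limit of `(Φ β)_{β < γ}` if `γ` is zero or a limit ordinal. -/
structure FinalSequence (F : C ⥤ C) where
  seq : Ordinal.{w}ᵒᵖ ⥤ C
  obj_succ : ∀ β : Ordinal.{w}, seq.obj (op (Order.succ β)) = F.obj (seq.obj (op β))
  map_succ : ∀ {β β' : Ordinal.{w}} (h : β ≤ β'),
    seq.map (homOfLE (Order.succ_le_succ h)).op =
      eqToHom (obj_succ β') ≫ F.map (seq.map (homOfLE h).op) ≫ eqToHom (obj_succ β).symm
  isLimit : ∀ γ : Ordinal.{w}, Order.IsSuccPrelimit γ → Nonempty (IsLimit (restrictionCone seq γ))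

namespace FinalSequence

variable {F : C ⥤ C} (Φ : FinalSequence.{w} F)

/-- The final sequence is stable at `α` if `Φ (α + 1) ⟶ Φ α` is an isomorphism. -/
def StableAt (α : Ordinal.{w}) : Prop :=
  IsIso (Φ.seq.map (homOfLE (Order.le_succ α)).op)

/-- The restriction of the final sequence to the stages `β ≤ α` is a sheaf. -/
def sheaf (α : Ordinal.{w}) : Sh α C where
  obj := (Subtype.mono_coe (· ∈ Set.Iic α)).functor.op ⋙ Φ.seq
  property := by
    intro E β S hS x hx
    -- restricting `x` at `f` to a smaller stage
    have hr : ∀ {δ δ' : Stage α} (f : δ ⟶ β) (f' : δ' ⟶ β) (hf : S f) (hf' : S f') (g : δ' ⟶ δ),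
        x f hf ≫ Φ.seq.map (homOfLE (leOfHom g : δ'.1 ≤ δ.1)).op = x f' hf' := by
      intro δ δ' f f' hf hf' g
      have h := hx g (𝟙 δ') hf hf' (Subsingleton.elim _ _)
      have h' : x f hf ≫ Φ.seq.map (homOfLE (leOfHom g : δ'.1 ≤ δ.1)).op =
        x f' hf' ≫ Φ.seq.map (𝟙 _) := h
      rw [Φ.seq.map_id] at h'
      exact h'.trans (Category.comp_id _)
    by_cases hβ : S (𝟙 β)
    · refine ⟨x (𝟙 β) hβ, fun δ f hf => hr _ _ hβ hf f, fun y hy => ?_⟩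
      have h : y ≫ Φ.seq.map (𝟙 _) = x (𝟙 β) hβ := hy _ hβ
      rw [Φ.seq.map_id] at h
      exact (Category.comp_id _).symm.trans h
    · have hlt : ∀ {δ : Stage α} (f : δ ⟶ β), S f → δ.1 < β.1 := by
        intro δ f hf
        refine lt_of_le_of_ne (leOfHom f) fun h => hβ ?_
        obtain rfl : δ = β := Subtype.ext h
        exact (Subsingleton.elim f (𝟙 δ)) ▸ hf
      have hmem : ∀ γ : Ordinal.{w}, ∀ h : γ < β.1,
          S (homOfLE h.le : (⟨γ, h.le.trans β.2⟩ : Stage α) ⟶ β) := by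
        intro γ h
        obtain ⟨δ, f, hf, hδ⟩ := hS γ h
        have h' : (⟨γ, h.le.trans β.2⟩ : Stage α) ≤ δ := hδ.le
        have h'' := S.downward_closed hf (homOfLE h')
        rwa [Subsingleton.elim (homOfLE h' ≫ f) (homOfLE h.le)] at h''
      have hp : Order.IsSuccPrelimit β.1 := by
        intro γ hγ
        obtain ⟨δ, f, hf, hδ⟩ := hS γ hγ.lt
        exact hγ.2 hδ (hlt f hf)
      obtain ⟨hl⟩ := Φ.isLimit β.1 hp
      let s : Cone ((Subtype.mono_coe (· ∈ Set.Iio β.1)).functor.op ⋙ Φ.seq) :=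
        { pt := E
          π :=
            { app := fun γ => x _ (hmem γ.unop.1 γ.unop.2)
              naturality := fun γ γ' f => by
                have h : (⟨γ'.unop.1, (le_of_lt (Set.mem_Iio.1 γ'.unop.2)).trans β.2⟩ : Stage α) ≤
                  ⟨γ.unop.1, (le_of_lt (Set.mem_Iio.1 γ.unop.2)).trans β.2⟩ := leOfHom f.unop
                exact (Category.id_comp _).trans
                  (hr _ _ (hmem γ.unop.1 γ.unop.2) (hmem γ'.unop.1 γ'.unop.2) (homOfLE h)).symm } }
      refine ⟨hl.lift s, fun δ f hf => hl.fac s (op ⟨δ.1, hlt f hf⟩), fun y hy => ?_⟩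
      exact hl.uniq s y fun γ => hy _ (hmem γ.unop.1 γ.unop.2)

section Identity

variable {α : Ordinal.{w}} [HasWeakSheafify (alexandrov α) C]

/-- An isomorphism from the final sequence to its guarded pointwise extension is the identity if at
each successor stage `β + 1` it is the canonical identification
`Φ (β + 1) = F (Φ β) = F (Φ (p (β + 1))) ≅ F ((later Φ) (β + 1)) ≅ (extP F (later Φ)) (β + 1)`,
where the isomorphisms are components of the unit of sheafification. -/
def IsIdentity (c : Φ.sheaf α ≅ (later α ⋙ extP α F).obj (Φ.sheaf α)) : Prop :=
  ∀ (β : Ordinal.{w}) (hβ : Order.succ β ∈ Set.Iic α),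
    c.hom.hom.app (op ⟨Order.succ β, hβ⟩) =
      eqToHom (Φ.obj_succ β) ≫
        F.map (Φ.seq.map (homOfLE (csSup_le' fun _ hγ => Order.lt_succ_iff.1 hγ :
          (pred (⟨Order.succ β, hβ⟩ : Stage α)).1 ≤ β)).op) ≫
        F.map ((toSheafify (alexandrov α)
          ((pred_mono α).functor.op ⋙ (Φ.sheaf α).obj)).app (op ⟨Order.succ β, hβ⟩)) ≫
        (toSheafify (alexandrov α) (((later α).obj (Φ.sheaf α)).obj ⋙ F)).app
          (op ⟨Order.succ β, hβ⟩)

end Identity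

end FinalSequence

end FinalSequences

end KleisliTrace

end

namespace KleisliTrace

/-! ### Guarded recursion on the stages -/

section GuardedRecursion

variable {α : Ordinal.{w}} {C : Type u} [Category.{v} C]

/-! Sheafification inverts exactly the presheaf morphisms that are invertible at all successor
stages (`W_iff_isIso_succ`), and this class is stable under applying an endofunctor stagewise. Hence
at a successor stage `ε` the sheaf obtained from `X` by later, then `F`, then `T` is canonically `T
(F (X (pred ε)))`, with `pred ε < ε`. A morphism into a sheaf is determined by its components at
successor stages, so an equation `f = A ≫ W f ≫ B`, with `W` this guarded composite, prescribes `f`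
at `ε` from `f` at `pred ε`. Well-founded recursion on stages gives exactly one solution
(`existsUnique_guarded`, `existsUnique_guarded_hylomorphism`).

Every Kleisli morphism is `K g` followed by a component of the counit of the Kleisli adjunction, so
a lifting `H` is controlled by the functor it lifts. A coalgebra-to-algebra equation for `H` thereby
becomes an equation of the above form between sheaves (`IsKleisliLifting.exists_of_eq`). Unique
solvability of all such equations makes any invariant final as a coalgebra, initial as an algebra,
and unique up to unique isomorphism.

The identity of the final sequence is such an invariant. The presheaf morphism `ofPred`, from `F (Φ
(pred β))` to `Φ β`, is invertible at successor stages; it therefore factors through the canonical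
morphism to the guarded extension as an isomorphism of sheaves, whose inverse is the required `c`.
-/

lemma pred_succ_eq {β : Ordinal.{w}} (hβ : Order.succ β ∈ Set.Iic α) :
    (pred (⟨Order.succ β, hβ⟩ : Stage α)).1 = β :=
  le_antisymm (csSup_le' fun _ hγ => Order.lt_succ_iff.1 hγ)
    (le_csSup ⟨Order.succ β, fun _ hx => le_of_lt hx⟩ (Set.mem_Iio.2 (Order.lt_succ β)))

/-- This strict decrease makes the recursion well-founded. It is special to successors: at zero and
at limit stages `pred` is the identity. -/
lemma pred_lt {ε : Stage α} (hε : isSuccStage α ε) : pred ε < ε := by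
  obtain ⟨ε, hεα⟩ := ε
  obtain ⟨γ, rfl⟩ : ∃ γ, ε = Order.succ γ := hε
  change (pred (⟨Order.succ γ, hεα⟩ : Stage α)).1 < Order.succ γ
  rw [pred_succ_eq]
  exact Order.lt_succ γ

/-- The morphism of stages `pred δ ⟶ pred ε` induced by `δ ⟶ ε`. -/
noncomputable abbrev predMap {δ ε : Stage α} (g : δ ⟶ ε) : pred δ ⟶ pred ε := (pred_mono α).functor.map g

/-- The successor stages below `β`. -/
def succPresieve (β : Stage α) : Presieve β := fun ε _ => isSuccStage α ε

/-- A point `γ` of `β` lies in the open `γ + 1 ≤ β`. For `β = 0` the empty family covers. -/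
lemma generate_succPresieve_mem (β : Stage α) :
    Sieve.generate (succPresieve β) ∈ alexandrov α β := by
  intro γ hγ
  let δ : Stage α := ⟨Order.succ γ, (Order.succ_le_of_lt hγ).trans β.2⟩
  exact ⟨δ, homOfLE (Order.succ_le_of_lt hγ : δ.1 ≤ β.1),
    Sieve.le_generate _ _ _ (⟨γ, rfl⟩ : isSuccStage α δ), Order.lt_succ γ⟩

lemma isSheafFor_succPresieve {Z : (Stage α)ᵒᵖ ⥤ C} (hZ : Presheaf.IsSheaf (alexandrov α) Z)
    (E : C) (β : Stage α) :
    Presieve.IsSheafFor (Z ⋙ coyoneda.obj (op E)) (succPresieve β) :=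
  (Presieve.isSheafFor_iff_generate _).2 (hZ E _ (generate_succPresieve_mem β))

lemma hom_ext_succ {Z : (Stage α)ᵒᵖ ⥤ C} (hZ : Presheaf.IsSheaf (alexandrov α) Z) {E : C}
    {β : Stage α} {a b : E ⟶ Z.obj (op β)}
    (h : ∀ (ε : Stage α) (f : ε ⟶ β), isSuccStage α ε → a ≫ Z.map f.op = b ≫ Z.map f.op) :
    a = b :=
  (isSheafFor_succPresieve hZ E β).isSeparatedFor.ext fun ε f hf => h ε f hf

/-- Stages are linearly ordered, so compatibility on overlaps reduces to compatibility along
inclusions of one successor stage in another. -/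
lemma exists_glue_succ {Z : (Stage α)ᵒᵖ ⥤ C} (hZ : Presheaf.IsSheaf (alexandrov α) Z) {E : C}
    {β : Stage α} (s : ∀ (ε : Stage α) (_ : ε ⟶ β), isSuccStage α ε → (E ⟶ Z.obj (op ε)))
    (hs : ∀ (δ ε : Stage α) (f : ε ⟶ β) (f' : δ ⟶ β) (g : δ ⟶ ε) (hδ : isSuccStage α δ)
      (hε : isSuccStage α ε), s ε f hε ≫ Z.map g.op = s δ f' hδ) :
    ∃ a : E ⟶ Z.obj (op β), ∀ (ε : Stage α) (f : ε ⟶ β) (hε : isSuccStage α ε),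
      a ≫ Z.map f.op = s ε f hε := by
  let x : Presieve.FamilyOfElements (Z ⋙ coyoneda.obj (op E)) (succPresieve β) :=
    fun ε f hε => s ε f hε
  have key : ∀ (δ ε W : Stage α) (f : ε ⟶ β) (f' : δ ⟶ β) (g : W ⟶ ε) (g' : W ⟶ δ)
      (hδ : isSuccStage α δ) (hε : isSuccStage α ε), δ ≤ ε →
      s ε f hε ≫ Z.map g.op = s δ f' hδ ≫ Z.map g'.op := by
    intro δ ε W f f' g g' hδ hε hle
    rw [← hs δ ε f f' (homOfLE hle) hδ hε, Category.assoc, ← Z.map_comp]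
    rfl
  have hx : x.Compatible := by
    intro ε δ W g g' f f' hε hδ _
    change s ε f hε ≫ Z.map g.op = s δ f' hδ ≫ Z.map g'.op
    rcases le_total δ ε with h | h
    · exact key δ ε W f f' g g' hδ hε h
    · exact (key ε δ W f' f g' g hε hδ h).symm
  obtain ⟨a, ha, -⟩ := isSheafFor_succPresieve hZ E β x hx
  exact ⟨a, fun ε f hε => ha f hε⟩

lemma natTrans_ext_succ {Y Z : (Stage α)ᵒᵖ ⥤ C} (hZ : Presheaf.IsSheaf (alexandrov α) Z)
    {f g : Y ⟶ Z} (h : ∀ ε : Stage α, isSuccStage α ε → f.app (op ε) = g.app (op ε)) : f = g := by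
  ext ⟨β⟩
  refine hom_ext_succ hZ fun ε k hε => ?_
  rw [← f.naturality, ← g.naturality, h ε hε]

/-! ### Well-founded recursion on stages -/

variable {Y Z : (Stage α)ᵒᵖ ⥤ C}
  (step : ∀ ε : Stage α, isSuccStage α ε →
    (Y.obj (op (pred ε)) ⟶ Z.obj (op (pred ε))) → (Y.obj (op ε) ⟶ Z.obj (op ε)))

/-- The morphisms at a stage obtained by recursion from `step`: at the successor stages below, they
restrict to the values of `step` at morphisms obtained by recursion. -/
inductive IsRec : ∀ β : Stage α, (Y.obj (op β) ⟶ Z.obj (op β)) → Prop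
  | mk (β : Stage α) (a : Y.obj (op β) ⟶ Z.obj (op β))
      (h : ∀ ε : Stage α, isSuccStage α ε → (ε ⟶ β) →
        (Y.obj (op (pred ε)) ⟶ Z.obj (op (pred ε))))
      (hh : ∀ ε hε f, IsRec (pred ε) (h ε hε f))
      (ha : ∀ ε hε (f : ε ⟶ β), a ≫ Z.map f.op = Y.map f.op ≫ step ε hε (h ε hε f)) : IsRec β a

variable {step}

lemma IsRec.eq (hZ : Presheaf.IsSheaf (alexandrov α) Z) {β : Stage α}
    {a b : Y.obj (op β) ⟶ Z.obj (op β)} (ha : IsRec step β a) (hb : IsRec step β b) : a = b := by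
  induction β using WellFoundedLT.induction with
  | ind β ih =>
    obtain ⟨_, _, h, hh, ha⟩ := ha
    obtain ⟨_, _, k, hk, hb⟩ := hb
    refine hom_ext_succ hZ fun ε f hε => ?_
    rw [ha ε hε f, hb ε hε f,
      ih (pred ε) ((pred_lt hε).trans_le (leOfHom f)) (hh ε hε f) (hk ε hε f)]

/-- No further induction is needed: below each successor stage both sides restrict to a value of
`step`, and the arguments of `step` agree by `IsRec.eq`. -/
lemma IsRec.naturality (hZ : Presheaf.IsSheaf (alexandrov α) Z) {β δ : Stage α} (g : δ ⟶ β)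
    {a : Y.obj (op β) ⟶ Z.obj (op β)} {b : Y.obj (op δ) ⟶ Z.obj (op δ)}
    (ha : IsRec step β a) (hb : IsRec step δ b) : a ≫ Z.map g.op = Y.map g.op ≫ b := by
  obtain ⟨_, _, h, hh, ha⟩ := ha
  obtain ⟨_, _, k, hk, hb⟩ := hb
  refine hom_ext_succ hZ fun ε f hε => ?_
  rw [Category.assoc, Category.assoc, hb ε hε f, ← Z.map_comp, ← Y.map_comp_assoc, ← op_comp,
    ha ε hε (f ≫ g), (hh ε hε (f ≫ g)).eq hZ (hk ε hε f)]

/-- Gluing at `β` requires the morphisms already built at smaller stages to be compatible. As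
`IsRec` is a predicate, uniqueness and naturality are available before existence, and `hstep`
carries this compatibility from predecessors to successors. -/
lemma IsRec.exists (hZ : Presheaf.IsSheaf (alexandrov α) Z)
    (hstep : ∀ (δ ε : Stage α) (hδ : isSuccStage α δ) (hε : isSuccStage α ε) (g : δ ⟶ ε)
    (a : Y.obj (op (pred ε)) ⟶ Z.obj (op (pred ε)))
    (b : Y.obj (op (pred δ)) ⟶ Z.obj (op (pred δ))),
    a ≫ Z.map (predMap g).op = Y.map (predMap g).op ≫ b →
    step ε hε a ≫ Z.map g.op = Y.map g.op ≫ step δ hδ b)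
    (β : Stage α) :
    ∃ a, IsRec step β a := by
  induction β using WellFoundedLT.induction with
  | ind β ih =>
    choose h hh using fun (ε : Stage α) (hε : isSuccStage α ε) (f : ε ⟶ β) =>
      ih (pred ε) ((pred_lt hε).trans_le (leOfHom f))
    obtain ⟨a, ha⟩ := exists_glue_succ hZ (fun ε f hε => Y.map f.op ≫ step ε hε (h ε hε f))
      (by
        intro δ ε f f' g hδ hε
        rw [Category.assoc, hstep δ ε hδ hε g _ _
          ((hh ε hε f).naturality hZ (predMap g) (hh δ hδ f')), ← Y.map_comp_assoc]
        rfl)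
    exact ⟨a, .mk β a h hh fun ε hε f => ha ε f hε⟩

/-- Guarded recursion: if `step` sends compatible morphisms at predecessors to compatible morphisms
at successor stages, there is a unique morphism to a sheaf whose components satisfy the
recursion. -/
lemma existsUnique_guarded (hZ : Presheaf.IsSheaf (alexandrov α) Z)
    (hstep : ∀ (δ ε : Stage α) (hδ : isSuccStage α δ) (hε : isSuccStage α ε) (g : δ ⟶ ε)
    (a : Y.obj (op (pred ε)) ⟶ Z.obj (op (pred ε)))
    (b : Y.obj (op (pred δ)) ⟶ Z.obj (op (pred δ))),
    a ≫ Z.map (predMap g).op = Y.map (predMap g).op ≫ b →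
    step ε hε a ≫ Z.map g.op = Y.map g.op ≫ step δ hδ b) :
    ∃! f : Y ⟶ Z, ∀ (ε : Stage α) (hε : isSuccStage α ε),
      f.app (op ε) = step ε hε (f.app (op (pred ε))) := by
  choose a ha using IsRec.exists hZ hstep
  let f : Y ⟶ Z :=
    { app := fun β => a β.unop
      naturality := fun β δ g => ((ha β.unop).naturality hZ g.unop (ha δ.unop)).symm }
  -- Any solution satisfies `IsRec` at every stage, so uniqueness of solutions reduces to
  -- `IsRec.eq`.
  have rec_of : ∀ g : Y ⟶ Z, (∀ (ε : Stage α) (hε : isSuccStage α ε),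
      g.app (op ε) = step ε hε (g.app (op (pred ε)))) → ∀ β, IsRec step β (g.app (op β)) := by
    intro g hg β
    induction β using WellFoundedLT.induction with
    | ind β ih =>
      refine .mk β _ (fun ε _ _ => g.app (op (pred ε)))
        (fun ε hε f => ih _ ((pred_lt hε).trans_le (leOfHom f))) fun ε hε f => ?_
      rw [← g.naturality, hg ε hε]
  refine ⟨f, fun ε hε => ?_, fun g hg => ?_⟩
  · change a ε = step ε hε (a (pred ε))
    obtain ⟨_, _, h, hh, hs⟩ := ha ε
    -- A successor stage belongs to its own cover; restricting along its identity yields the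
    -- recursion equation.
    have := hs ε hε (𝟙 ε)
    rw [op_id, Z.map_id, Y.map_id, Category.comp_id, Category.id_comp] at this
    rw [this, (hh ε hε (𝟙 ε)).eq hZ (ha (pred ε))]
  · ext ⟨β⟩
    exact (rec_of g hg β).eq hZ (ha β)

end GuardedRecursion

/-! ### Guarded pointwise extensions -/

section Guarded

variable {α : Ordinal.{w}} {C : Type u} [Category.{v} C] [HasWeakSheafify (alexandrov α) C]

/-- The canonical morphism from the pointwise application of `E` to the pointwise extension. -/
noncomputable abbrev extUnit (E : C ⥤ C) (X : Sh α C) : X.obj ⋙ E ⟶ ((extP α E).obj X).obj :=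
  toSheafify (alexandrov α) (X.obj ⋙ E)

/-- The canonical morphism from the presheaf `β ↦ F (X (pred β))`. -/
noncomputable def guardedUnit (F : C ⥤ C) (X : Sh α C) :
    (pred_mono α).functor.op ⋙ X.obj ⋙ F ⟶ ((later α ⋙ extP α F).obj X).obj :=
  Functor.whiskerRight (toSheafify (alexandrov α) ((pred_mono α).functor.op ⋙ X.obj)) F ≫
    extUnit F ((later α).obj X)

lemma extUnit_naturality (E : C ⥤ C) {X Y : Sh α C} (f : X ⟶ Y) :
    extUnit E X ≫ ((extP α E).map f).hom = Functor.whiskerRight f.hom E ≫ extUnit E Y :=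
  (toSheafify_naturality (alexandrov α) (Functor.whiskerRight f.hom E)).symm

lemma guardedUnit_naturality (F : C ⥤ C) {X Y : Sh α C} (f : X ⟶ Y) :
    guardedUnit F X ≫ ((later α ⋙ extP α F).map f).hom =
      Functor.whiskerLeft (pred_mono α).functor.op (Functor.whiskerRight f.hom F) ≫
        guardedUnit F Y := by
  have h : CommSq (toSheafify (alexandrov α) ((pred_mono α).functor.op ⋙ X.obj))
      (Functor.whiskerLeft (pred_mono α).functor.op f.hom) ((later α).map f).hom
      (toSheafify (alexandrov α) ((pred_mono α).functor.op ⋙ Y.obj)) :=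
    ⟨(toSheafify_naturality (alexandrov α)
      (Functor.whiskerLeft (pred_mono α).functor.op f.hom)).symm⟩
  have h₁ := h.map ((Functor.whiskeringRight _ _ _).obj F)
  have h₂ := CommSq.mk (extUnit_naturality F ((later α).map f))
  exact (h₁.horiz_comp h₂).w

/-- Consequently the guarded extension of `X` at a successor stage `ε` is `F (X (pred ε))`, although
its definition sheafifies twice. -/
lemma W_guardedUnit (F : C ⥤ C) (X : Sh α C) : (alexandrov α).W (guardedUnit F X) :=
  (alexandrov α).W.comp_mem _ _
    (W_whiskerRight _ ((alexandrov α).W_toSheafify _) F) ((alexandrov α).W_toSheafify _)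

/-- The canonical morphism from the presheaf `β ↦ E (F (X (pred β)))`. -/
noncomputable def guardedUnit₂ (F E : C ⥤ C) (X : Sh α C) :
    (pred_mono α).functor.op ⋙ X.obj ⋙ F ⋙ E ⟶
      ((extP α E).obj ((later α ⋙ extP α F).obj X)).obj :=
  Functor.whiskerRight (guardedUnit F X) E ≫ extUnit E _

lemma guardedUnit₂_naturality (F E : C ⥤ C) {X Y : Sh α C} (f : X ⟶ Y) :
    guardedUnit₂ F E X ≫ ((extP α E).map ((later α ⋙ extP α F).map f)).hom =
      Functor.whiskerLeft (pred_mono α).functor.op (Functor.whiskerRight f.hom (F ⋙ E)) ≫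
        guardedUnit₂ F E Y := by
  have h₁ := (CommSq.mk (guardedUnit_naturality F f)).map ((Functor.whiskeringRight _ _ _).obj E)
  have h₂ := CommSq.mk (extUnit_naturality E ((later α ⋙ extP α F).map f))
  exact (h₁.horiz_comp h₂).w

lemma W_guardedUnit₂ (F E : C ⥤ C) (X : Sh α C) : (alexandrov α).W (guardedUnit₂ F E X) :=
  (alexandrov α).W.comp_mem _ _ (W_whiskerRight _ (W_guardedUnit F X) E)
    ((alexandrov α).W_toSheafify _)

/-- Every equation `f = A ≫ W f ≫ B` for a guarded functor `W` has a unique solution. -/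
lemma existsUnique_guarded_hylomorphism (F E : C ⥤ C) {Y Z : Sh α C}
    (A : Y ⟶ (extP α E).obj ((later α ⋙ extP α F).obj Y))
    (B : (extP α E).obj ((later α ⋙ extP α F).obj Z) ⟶ Z) :
    ∃! f : Y ⟶ Z, f = A ≫ (extP α E).map ((later α ⋙ extP α F).map f) ≫ B := by
  have hiso : ∀ ε : Stage α, isSuccStage α ε → IsIso ((guardedUnit₂ F E Y).app (op ε)) :=
    fun ε hε => isIso_succ_of_W _ (W_guardedUnit₂ F E Y) ε hε
  -- The right-hand side of the equation at `ε`, read through `guardedUnit₂`: it depends on `f` only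
  -- at `pred ε`. Only the unit for `Y` has to be inverted.
  let step : ∀ ε : Stage α, isSuccStage α ε →
      (Y.obj.obj (op (pred ε)) ⟶ Z.obj.obj (op (pred ε))) →
      (Y.obj.obj (op ε) ⟶ Z.obj.obj (op ε)) := fun ε hε a =>
    haveI := hiso ε hε
    A.hom.app (op ε) ≫ (inv ((guardedUnit₂ F E Y).app (op ε)) ≫ (F ⋙ E).map a ≫
      (guardedUnit₂ F E Z).app (op ε)) ≫ B.hom.app (op ε)
  have hstep : ∀ (δ ε : Stage α) (hδ : isSuccStage α δ) (hε : isSuccStage α ε) (g : δ ⟶ ε)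
      (a : Y.obj.obj (op (pred ε)) ⟶ Z.obj.obj (op (pred ε)))
      (b : Y.obj.obj (op (pred δ)) ⟶ Z.obj.obj (op (pred δ))),
      a ≫ Z.obj.map (predMap g).op = Y.obj.map (predMap g).op ≫ b →
      step ε hε a ≫ Z.obj.map g.op = Y.obj.map g.op ≫ step δ hδ b := by
    intro δ ε hδ hε g a b hab
    have := hiso ε hε
    have := hiso δ hδ
    have hA := CommSq.mk (A.hom.naturality g.op).symm
    have hB := CommSq.mk (B.hom.naturality g.op).symm
    have hY : CommSq (inv ((guardedUnit₂ F E Y).app (op ε))) _ _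
        (inv ((guardedUnit₂ F E Y).app (op δ))) :=
      CommSq.horiz_inv (f := asIso _) (i := asIso _)
        (CommSq.mk ((guardedUnit₂ F E Y).naturality g.op).symm)
    have hZ := CommSq.mk ((guardedUnit₂ F E Z).naturality g.op).symm
    have hab' := (CommSq.mk hab).map (F ⋙ E)
    -- Five commuting squares are pasted: naturality of `A`, of the inverted unit, the hypothesis
    -- under `F ⋙ E`, naturality of the other unit, and of `B`.
    exact (hA.horiz_comp ((hY.horiz_comp (hab'.horiz_comp hZ)).horiz_comp hB)).w
  have hiff : ∀ f : Y ⟶ Z, f = A ≫ (extP α E).map ((later α ⋙ extP α F).map f) ≫ B ↔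
      ∀ (ε : Stage α) (hε : isSuccStage α ε),
        f.hom.app (op ε) = step ε hε (f.hom.app (op (pred ε))) := by
    intro f
    have h : ∀ (ε : Stage α) (hε : isSuccStage α ε),
        (A ≫ (extP α E).map ((later α ⋙ extP α F).map f) ≫ B).hom.app (op ε) =
          step ε hε (f.hom.app (op (pred ε))) := by
      intro ε hε
      have := hiso ε hε
      have hn : (guardedUnit₂ F E Y).app (op ε) ≫ _ = (F ⋙ E).map (f.hom.app (op (pred ε))) ≫ _ :=
        congrArg (fun k => NatTrans.app k (op ε)) (guardedUnit₂_naturality F E f)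
      have hn' := (IsIso.eq_inv_comp _).2 hn
      exact congrArg (fun k => A.hom.app (op ε) ≫ k ≫ B.hom.app (op ε)) hn'
    constructor
    · intro hf ε hε
      rw [← h ε hε, ← hf]
    · intro hf
      apply Sheaf.hom_ext
      exact natTrans_ext_succ Z.property fun ε hε => (hf ε hε).trans (h ε hε).symm
  obtain ⟨f, hf, hu⟩ := existsUnique_guarded Z.property hstep
  refine ⟨⟨f⟩, (hiff _).2 hf, fun g hg => ?_⟩
  apply Sheaf.hom_ext
  exact hu _ ((hiff g).1 hg)

end Guarded

end KleisliTrace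

namespace KleisliTrace

/-! ### Unique invariants from unique solutions of recursive equations -/

section Invariants

/-- If every coalgebra-to-algebra equation has a unique solution, every invariant is the unique
one. -/
lemma isUniqueInvariant_of_existsUnique {D : Type*} [Category* D] {H : D ⥤ D}
    (hH : ∀ (Y X : D) (a : Y ⟶ H.obj Y) (b : H.obj X ⟶ X), ∃! f : Y ⟶ X, f = a ≫ H.map f ≫ b)
    {X : D} (e : X ≅ H.obj X) : IsUniqueInvariant H e := by
  -- With an inverted structure map on the target (resp. source), solutions are exactly coalgebra
  -- (resp. algebra) morphisms.
  have hfin : ∀ (Y X : D) (a : Y ⟶ H.obj Y) (e : X ≅ H.obj X) (f : Y ⟶ X),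
      f = a ≫ H.map f ≫ e.inv ↔ a ≫ H.map f = f ≫ e.hom := by
    intro Y X a e f
    rw [← Category.assoc, ← Iso.comp_inv_eq, eq_comm, Category.assoc]
  have hini : ∀ (Y : D) (b : H.obj Y ⟶ Y) (f : X ⟶ Y),
      f = e.hom ≫ H.map f ≫ b ↔ H.map f ≫ b = e.inv ≫ f := by
    intro Y b f
    rw [Iso.eq_inv_comp, eq_comm]
  refine ⟨fun Y k => ?_, ⟨?_⟩, ⟨?_⟩⟩
  · obtain ⟨f, hf, hf'⟩ := hH Y X k.hom e.inv
    obtain ⟨g, hg, -⟩ := hH X Y e.hom k.inv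
    have hf₁ := (hfin _ _ _ _ _).1 hf
    have hg₁ := (hfin _ _ _ _ _).1 hg
    -- A coalgebra endomorphism of an invariant solves the same equation as the identity; applied
    -- below to both composites of `f` and `g`.
    have id_of : ∀ (Z : D) (l : Z ≅ H.obj Z) (h : Z ⟶ Z), l.hom ≫ H.map h = h ≫ l.hom →
        h = 𝟙 Z := by
      intro Z l h hh
      refine (hH Z Z l.hom l.inv).unique ((hfin _ _ _ _ _).2 hh) ((hfin _ _ _ _ _).2 ?_)
      rw [H.map_id, Category.comp_id, Category.id_comp]
    refine ⟨⟨f, g, id_of Y k _ ?_, id_of X e _ ?_⟩, hf₁, fun i hi => ?_⟩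
    · rw [H.map_comp, reassoc_of% hf₁, hg₁, Category.assoc]
    · rw [H.map_comp, reassoc_of% hg₁, hf₁, Category.assoc]
    · ext
      exact hf' _ ((hfin _ _ _ _ _).2 hi)
  · have h := fun V : Endofunctor.Coalgebra H => hH V.V X V.str e.inv
    refine IsTerminal.ofUniqueHom (fun V => ⟨(h V).choose, ?_⟩) fun V m => ?_
    · exact (hfin _ _ _ _ _).1 (h V).choose_spec.1
    · ext
      exact (h V).choose_spec.2 _ ((hfin _ _ _ _ _).2 m.h)
  · have h := fun A : Endofunctor.Algebra H => hH X A.a e.hom A.str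
    refine IsInitial.ofUniqueHom (fun A => ⟨(h A).choose, ?_⟩) fun A m => ?_
    · exact (hini _ _ _).1 (h A).choose_spec.1
    · ext
      exact (h A).choose_spec.2 _ ((hini _ _ _).2 m.h)

end Invariants

/-! ### Reduction of Kleisli equations to equations between sheaves -/

section KleisliLifting

/-- A Kleisli lifting acts on a Kleisli morphism through the functor it lifts. -/
lemma IsKleisliLifting.exists_of_eq {D : Type*} [Category* D] {M : Monad D} {G : D ⥤ D}
    {H : Kleisli M ⥤ Kleisli M} (hH : IsKleisliLifting M G H) {Y X : D}
    (a : (Kleisli.Adjunction.toKleisli M).obj Y ⟶ H.obj ((Kleisli.Adjunction.toKleisli M).obj Y))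
    (b : H.obj ((Kleisli.Adjunction.toKleisli M).obj X) ⟶
      (Kleisli.Adjunction.toKleisli M).obj X) :
    ∃ (A : Y ⟶ M.obj (G.obj Y)) (B : M.obj (G.obj (M.obj X)) ⟶ M.obj X),
      ∀ g : Y ⟶ M.obj X, (a ≫ H.map ⟨g⟩ ≫ b).of = A ≫ M.map (G.map g) ≫ B := by
  let K := Kleisli.Adjunction.toKleisli M
  -- The counit of the Kleisli adjunction; `H ε` does not depend on `g`, so it can be absorbed into
  -- `b'`.
  let ε : K.obj (M.obj X) ⟶ K.obj X := ⟨𝟙 (M.obj X)⟩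
  let a' : K.obj Y ⟶ K.obj (G.obj Y) := a ≫ eqToHom (Functor.congr_obj hH Y)
  let b' : K.obj (G.obj (M.obj X)) ⟶ K.obj X :=
    eqToHom (Functor.congr_obj hH (M.obj X)).symm ≫ H.map ε ≫ b
  have hK : ∀ {U V W : D} (g : U ⟶ V) (q : V ⟶ M.obj W),
      (g ≫ M.η.app V) ≫ M.map q ≫ M.μ.app W = g ≫ q := by
    intro U V W g q
    have h := M.η.naturality q
    rw [Category.assoc, ← reassoc_of% h, M.left_unit]
    exact congrArg (g ≫ ·) (Category.comp_id q)
  have hKl : ∀ {U V W Z : D} (p : U ⟶ M.obj V) (g : V ⟶ W) (q : W ⟶ M.obj Z),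
      p ≫ M.map ((g ≫ M.η.app W) ≫ M.map q ≫ M.μ.app Z) ≫ M.μ.app Z =
        p ≫ M.map g ≫ M.map q ≫ M.μ.app Z := by
    intro U V W Z p g q
    rw [hK, M.map_comp, Category.assoc]
  refine ⟨a'.of, M.map b'.of ≫ M.μ.app X, fun g => ?_⟩
  let f : K.obj Y ⟶ K.obj X := ⟨g⟩
  have hf : f = K.map g ≫ ε :=
    Kleisli.hom_ext ((hK g (𝟙 (M.obj X))).trans (Category.comp_id g)).symm
  have h : H.map (K.map g) = eqToHom _ ≫ K.map (G.map g) ≫ eqToHom _ := Functor.congr_hom hH g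
  have hm : a ≫ H.map f ≫ b = a' ≫ K.map (G.map g) ≫ b' := by
    rw [hf, H.map_comp, h]
    simp only [a', b', Category.assoc]
  exact (congrArg Kleisli.Hom.of hm).trans (hKl a'.of (G.map g) b'.of)

variable {C : Type u} [Category.{v} C] {α : Ordinal.{w}} [HasWeakSheafify (alexandrov α) C]

/-- Coalgebra-to-algebra equations for Kleisli liftings of guarded functors have unique
solutions. -/
lemma IsKleisliLifting.existsUnique_hylomorphism {T : Monad C} {F : C ⥤ C}
    {H : Kleisli (extMonad α T) ⥤ Kleisli (extMonad α T)}
    (hH : IsKleisliLifting (extMonad α T) (later α ⋙ extP α F) H) (Y X : Kleisli (extMonad α T))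
    (a : Y ⟶ H.obj Y) (b : H.obj X ⟶ X) : ∃! f : Y ⟶ X, f = a ≫ H.map f ≫ b := by
  -- The underlying functor of `extMonad α T` is `extP α T` by definition, so the guarded equation
  -- arises with `E = T`.
  obtain ⟨A, B, h⟩ := hH.exists_of_eq (Y := Y.of) (X := X.of) a b
  obtain ⟨f, hf, hu⟩ := existsUnique_guarded_hylomorphism F T.toFunctor A B
  refine ⟨⟨f⟩, Kleisli.hom_ext (hf.trans (h f).symm), fun g hg => Kleisli.hom_ext (hu _ ?_)⟩
  exact (congrArg Kleisli.Hom.of hg).trans (h g.of)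

end KleisliLifting

/-! ### The identity of the final sequence as an invariant -/

namespace FinalSequence

variable {C : Type u} [Category.{v} C] {F : C ⥤ C} (Φ : FinalSequence.{w} F) {α : Ordinal.{w}}

/-- An equality at successor stages. At zero and limits it is strict, and there `ofPred` contains a
genuine transition map. -/
lemma le_succ_pred (β : Stage α) : β.1 ≤ Order.succ (pred β).1 :=
  le_of_forall_lt fun _ hγ => Order.lt_succ_iff.2 (le_csSup ⟨β.1, fun _ hx => le_of_lt hx⟩ hγ)

/-- By `map_succ`, `F` of a transition map is a transition map between successors, so everything
composes inside `Φ`. This gives the naturality of `ofPred`. -/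
lemma map_map_comp {β β' δ : Ordinal.{w}} (h : β ≤ β') (hδ : δ ≤ Order.succ β) :
    F.map (Φ.seq.map (homOfLE h).op) ≫ eqToHom (Φ.obj_succ β).symm ≫ Φ.seq.map (homOfLE hδ).op =
      eqToHom (Φ.obj_succ β').symm ≫
        Φ.seq.map (homOfLE (hδ.trans (Order.succ_le_succ h))).op := by
  have e : (homOfLE (hδ.trans (Order.succ_le_succ h))).op =
    (homOfLE (Order.succ_le_succ h)).op ≫ (homOfLE hδ).op := rfl
  rw [e, Φ.seq.map_comp, Φ.map_succ h]
  simp only [Category.assoc, eqToHom_trans_assoc, eqToHom_refl, Category.id_comp]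

/-- The morphisms `F (Φ (pred β)) = Φ (pred β + 1) ⟶ Φ β`. -/
noncomputable def ofPred (α : Ordinal.{w}) :
    (pred_mono α).functor.op ⋙ (Φ.sheaf α).obj ⋙ F ⟶ (Φ.sheaf α).obj where
  app β := eqToHom (Φ.obj_succ (pred β.unop).1).symm ≫
    Φ.seq.map (homOfLE (le_succ_pred β.unop)).op
  naturality β δ g := by
    have hle : (pred δ.unop).1 ≤ (pred β.unop).1 := pred_mono α (leOfHom g.unop)
    refine (Φ.map_map_comp hle (le_succ_pred δ.unop)).trans (Eq.trans ?_
      (Category.assoc _ _ _).symm)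
    exact congrArg _ (Φ.seq.map_comp (homOfLE (le_succ_pred β.unop)).op
      (homOfLE (leOfHom g.unop : δ.unop.1 ≤ β.unop.1)).op)

/-- At a successor stage, `ofPred` is inverse to the canonical identification. -/
lemma identification_comp_ofPred {β : Ordinal.{w}} (hβ : Order.succ β ∈ Set.Iic α)
    (h : (pred (⟨Order.succ β, hβ⟩ : Stage α)).1 ≤ β) :
    eqToHom (Φ.obj_succ β) ≫ F.map (Φ.seq.map (homOfLE h).op) ≫
      (Φ.ofPred α).app (op ⟨Order.succ β, hβ⟩) = 𝟙 _ := by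
  refine (congrArg _ (Φ.map_map_comp h (le_succ_pred ⟨Order.succ β, hβ⟩))).trans ?_
  refine (eqToHom_trans_assoc _ _ _).trans ((Category.id_comp _).trans ?_)
  exact Φ.seq.map_id _

lemma isIso_ofPred {β : Ordinal.{w}} (hβ : Order.succ β ∈ Set.Iic α) :
    IsIso ((Φ.ofPred α).app (op ⟨Order.succ β, hβ⟩)) := by
  have h := pred_succ_eq hβ
  -- Both ordinals are `β + 1`, so the inequality is invertible in the poset.
  have : IsIso (homOfLE (le_succ_pred (⟨Order.succ β, hβ⟩ : Stage α))) :=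
    ⟨homOfLE (Order.succ_le_succ h.le), Subsingleton.elim _ _, Subsingleton.elim _ _⟩
  exact inferInstanceAs (IsIso (eqToHom (Φ.obj_succ _).symm ≫
    Φ.seq.map (homOfLE (le_succ_pred (⟨Order.succ β, hβ⟩ : Stage α))).op))

variable [HasWeakSheafify (alexandrov α) C]

lemma isIdentity_unique {c c' : Φ.sheaf α ≅ (later α ⋙ extP α F).obj (Φ.sheaf α)}
    (hc : Φ.IsIdentity c) (hc' : Φ.IsIdentity c') : c = c' := by
  ext1
  apply Sheaf.hom_ext
  refine natTrans_ext_succ ((later α ⋙ extP α F).obj (Φ.sheaf α)).property ?_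
  rintro ⟨ε, hε⟩ ⟨β, hβ⟩
  obtain rfl : ε = Order.succ β := hβ
  exact (hc β hε).trans (hc' β hε).symm

lemma exists_isIdentity :
    ∃ c : Φ.sheaf α ≅ (later α ⋙ extP α F).obj (Φ.sheaf α), Φ.IsIdentity c := by
  have hθ := W_guardedUnit F (Φ.sheaf α)
  -- `guardedUnit` is inverted by sheafification and the target is a sheaf, so `ofPred` extends
  -- along it.
  obtain ⟨d, hd : guardedUnit F (Φ.sheaf α) ≫ d = Φ.ofPred α⟩ :=
    (hθ _ (Φ.sheaf α).property).2 (Φ.ofPred α)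
  have he : (alexandrov α).W (guardedUnit F (Φ.sheaf α) ≫ d) := by
    rw [hd]
    refine W_of_isIso_succ _ ?_
    rintro ⟨ε, hε⟩ ⟨β, hβ⟩
    obtain rfl : ε = Order.succ β := hβ
    exact Φ.isIso_ofPred hε
  -- By cancellation `d` is itself inverted by sheafification, and between sheaves this means that
  -- it is an isomorphism.
  have hW : (alexandrov α).W d := (alexandrov α).W.of_precomp _ _ hθ he
  let D : (later α ⋙ extP α F).obj (Φ.sheaf α) ⟶ Φ.sheaf α := ⟨d⟩
  have : IsIso D := ((alexandrov α).W_sheafToPresheaf_map_iff_isIso D).1 hW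
  let c := (asIso D).symm
  refine ⟨c, fun β hβ => ?_⟩
  let s : (Stage α)ᵒᵖ := op ⟨Order.succ β, hβ⟩
  have h₁ : c.hom.hom.app s ≫ d.app s = 𝟙 _ :=
    congrArg (fun k : Φ.sheaf α ⟶ Φ.sheaf α => k.hom.app s) c.hom_inv_id
  have h₂ : d.app s ≫ c.hom.hom.app s = 𝟙 _ :=
    congrArg (fun k : (later α ⋙ extP α F).obj (Φ.sheaf α) ⟶ _ => k.hom.app s) c.inv_hom_id
  have h₃ : (guardedUnit F (Φ.sheaf α)).app s ≫ d.app s = (Φ.ofPred α).app s :=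
    congrArg (fun k => NatTrans.app k s) hd
  have h₄ : (guardedUnit F (Φ.sheaf α)).app s = (Φ.ofPred α).app s ≫ c.hom.hom.app s := by
    rw [← h₃, Category.assoc, h₂, Category.comp_id]
  have h₅ := Φ.identification_comp_ofPred hβ (csSup_le' fun _ hγ => Order.lt_succ_iff.1 hγ)
  -- Cancels `ofPred`: the first part of the canonical identification is a one-sided inverse of it,
  -- which suffices to isolate `c`.
  have key : ∀ {P Q R V : C} (p : P ⟶ Q) (q : Q ⟶ R) (r : R ⟶ P) (t : R ⟶ V) (k : P ⟶ V),
      t = r ≫ k → p ≫ q ≫ r = 𝟙 P → k = p ≫ q ≫ t := by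
    rintro P Q R V p q r _ k rfl h
    rw [reassoc_of% h]
  exact key _ _ _ _ _ h₄ h₅

end FinalSequence

end KleisliTrace

theorem mainTheorem2 {C : Type u} [Category.{v} C] (T : Monad C) (F : C ⥤ C)
    (α : Ordinal.{w}) [HasWeakSheafify (KleisliTrace.alexandrov α) C]
    (Φ : KleisliTrace.FinalSequence.{w} F) (hΦ : Φ.StableAt α)
    (H : Kleisli (KleisliTrace.extMonad α T) ⥤ Kleisli (KleisliTrace.extMonad α T))
    (hH : KleisliTrace.IsKleisliLifting (KleisliTrace.extMonad α T)
      (KleisliTrace.later α ⋙ KleisliTrace.extP α F) H) :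
    (∃! c : Φ.sheaf α ≅ (KleisliTrace.later α ⋙ KleisliTrace.extP α F).obj (Φ.sheaf α),
      Φ.IsIdentity c) ∧
    ∀ c : Φ.sheaf α ≅ (KleisliTrace.later α ⋙ KleisliTrace.extP α F).obj (Φ.sheaf α),
      Φ.IsIdentity c → KleisliTrace.IsUniqueInvariant H (hH.mapInvariant c) := by
  obtain ⟨c, hc⟩ := Φ.exists_isIdentity (α := α)
  exact ⟨⟨c, hc, fun c' hc' => Φ.isIdentity_unique hc' hc⟩, fun c _ =>
    KleisliTrace.isUniqueInvariant_of_existsUnique hH.existsUnique_hylomorphism _⟩
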